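/- Let $\alpha>0$ and let $X\in\mathbb{R}^{m\times n}$ have $\operatorname{rank}X=r\le d\le\min(m,n)$. Let $\sigma_1(X)\ge\sigma_2(X)\ge\dots$ be the singular values of $X$, and let $\|\cdot\|$ be the Euclidean norm. Then for every $q\in\{1,\tfrac12,\tfrac14,\dots\}=\{2^{-k}:k=0,1,2,\dots\}$ $$\min_{X=\sum_{j=1}^d a_jb_j^T}\ \sum_{j=1}^d\Big(\tfrac1q\|a_j\|^q+\alpha\|b_j\|\Big)=\Big(1+\tfrac1q\Big)\alpha^{q/(q+1)}\sum_{j=1}^r\sigma_j(X)^{q/(q+1)},$$ $$\min_{X=\sum_{j=1}^d a_jb_j^T}\ \sum_{j=1}^d\Big(\tfrac1q\|a_j\|^q+\tfrac{\alpha}{2}\|b_j\|^2\Big)=\Big(\tfrac12+\tfrac1q\Big)\alpha^{q/(q+2)}\sum_{j=1}^r\sigma_j(X)^{2q/(2+q)},$$ where the minima run over all $a_1,\dots,a_d\in\mathbb{R}^m$ and $b_1,\dots,b_d\in\mathbb{R}^n$ with $X=\sum_{j=1}^d a_jb_j^T$, and are attained. In particular, with the Schatten-$p$ quasi-norm $\|X\|_{S_p}=\big(\sum_{j=1}^{\min(m,n)}\sigma_j(X)^p\big)^{1/p}$,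 for every $\varepsilon>0$ there is a $q\in\{1,\tfrac12,\tfrac14,\dots\}$ such that $p=\tfrac{q}{q+1}$ lies in $(0,\varepsilon)$ and the first minimum equals $(1+\tfrac1q)\,\alpha^{p}\,\|X\|_{S_p}^p$; likewise there is a $q\in\{1,\tfrac12,\tfrac14,\dots\}$ such that $p=\tfrac{2q}{2+q}$ lies in $(0,\varepsilon)$ and the second minimum equals $(\tfrac12+\tfrac1q)\,\alpha^{p/2}\,\|X\|_{S_p}^p$. -/

import Mathlib

noncomputable section

namespace FGSR

/-- The `j`-th largest singular value of a real `m × n` matrix, indexed from zero. -/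
def sv {m n : ℕ} (X : Matrix (Fin m) (Fin n) ℝ) (j : ℕ) : ℝ :=
  (Matrix.toEuclideanLin X).singularValues j

/-- The Schatten-`p` (quasi-)norm of a real `m × n` matrix. -/
def schatten {m n : ℕ} (p : ℝ) (X : Matrix (Fin m) (Fin n) ℝ) : ℝ :=
  (∑ j ∈ Finset.range (min m n), sv X j ^ p) ^ (1 / p)

/-- The admissible exponents `1, 1/2, 1/4, …`. -/
def exponents : Set ℝ := Set.range fun k : ℕ => ((1 : ℝ) / 2) ^ k

/-- The pair of families `(a, b)` is a factorization `X = ∑ j, a j * (b j)ᵀ` with `d` terms. -/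
def IsFactorization {m n d : ℕ} (X : Matrix (Fin m) (Fin n) ℝ)
    (a : Fin d → EuclideanSpace ℝ (Fin m)) (b : Fin d → EuclideanSpace ℝ (Fin n)) : Prop :=
  X = ∑ j, Matrix.vecMulVec (WithLp.ofLp (a j)) (WithLp.ofLp (b j))

/-- The values of `∑ j, ((1/q) ‖a j‖ ^ q + α ‖b j‖)` over all `d`-term factorizations of `X`. -/
def values₁ {m n : ℕ} (X : Matrix (Fin m) (Fin n) ℝ) (d : ℕ) (α q : ℝ) : Set ℝ :=
  {v | ∃ (a : Fin d → EuclideanSpace ℝ (Fin m)) (b : Fin d → EuclideanSpace ℝ (Fin n)),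
    IsFactorization X a b ∧ v = ∑ j, ((1 / q) * ‖a j‖ ^ q + α * ‖b j‖)}

/-- The values of `∑ j, ((1/q) ‖a j‖ ^ q + (α/2) ‖b j‖ ^ 2)` over all `d`-term factorizations
of `X`. -/
def values₂ {m n : ℕ} (X : Matrix (Fin m) (Fin n) ℝ) (d : ℕ) (α q : ℝ) : Set ℝ :=
  {v | ∃ (a : Fin d → EuclideanSpace ℝ (Fin m)) (b : Fin d → EuclideanSpace ℝ (Fin n)),
    IsFactorization X a b ∧ v = ∑ j, ((1 / q) * ‖a j‖ ^ q + (α / 2) * ‖b j‖ ^ 2)}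

end FGSR

end

/-! For one term with `‖a‖ * ‖b‖ = c`, weighted AM-GM shows that the least cost is `K * c ^ p`. It
therefore suffices to prove `∑ σ_j ^ p ≤ ∑ (‖a_j‖ * ‖b_j‖) ^ p` for `p ≤ 1`
(`sum_singularValues_rpow_le`); a singular value decomposition with optimally split factors attains
the bound (`isLeast_factorization_cost`).

For the inequality, sort the products decreasingly. Dropping the `k` largest terms is a perturbation
of rank at most `k`, so Weyl's inequality bounds `σ_(j+k)(X)` by `σ_j` of the remainder. The nuclear
norm of the remainder is at most the sum of its products. Hence every tail sum of the singular
values is dominated by that of the products, and concavity of `t ↦ t ^ p` passes this to `p`-th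
powers (`sum_rpow_le_of_tail_le`). -/

namespace FGSR

open Module

/-! ### Tail majorization and concave powers -/

section Majorization

/-- Abel summation inequality: a monotone nonnegative weight against a sequence with nonpositive
tail sums. -/
theorem sum_mul_le_of_tail_nonpos (d : ℕ) (w D : ℕ → ℝ) (hw : ∀ i j, i ≤ j → j < d → w i ≤ w j)
    (hD : ∀ k, ∑ j ∈ Finset.range (d - k), D (j + k) ≤ 0) :
    ∑ j ∈ Finset.range d, w j * D j ≤ w 0 * ∑ j ∈ Finset.range d, D j := by
  induction d generalizing w D with
  | zero => simp
  | succ d ih =>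
    rw [Finset.sum_range_succ', Finset.sum_range_succ' D, mul_add]
    gcongr
    refine (ih (fun j => w (j + 1)) (fun j => D (j + 1))
      (fun i j hij hj => hw _ _ (by omega) (by omega)) fun k => ?_).trans ?_
    · have := hD (k + 1)
      rwa [Nat.add_sub_add_right] at this
    -- Induction leaves the factor `w 1` on a nonpositive tail sum; lowering it to `w 0 ≤ w 1` only
    -- increases the product.
    · rcases d with _ | d
      · simp
      · have h := hD 1
        rw [Nat.add_sub_cancel] at h
        exact mul_le_mul_of_nonpos_right (hw 0 1 (by omega) (by omega)) h

/-- The graph of `t ↦ t ^ p`, `0 < p ≤ 1`, lies below its tangent lines. -/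
theorem rpow_le_tangent {p s c : ℝ} (hp : 0 < p) (hp1 : p ≤ 1) (hs : 0 ≤ s) (hc : 0 < c) :
    s ^ p ≤ c ^ p + p * c ^ (p - 1) * (s - c) := by
  have h := rpow_one_add_le_one_add_mul_self (s := s / c - 1)
    (by linarith [div_nonneg hs hc.le]) hp.le hp1
  rw [add_sub_cancel, Real.div_rpow hs hc.le, div_le_iff₀ (Real.rpow_pos_of_pos hc p)] at h
  refine h.trans_eq ?_
  rw [Real.rpow_sub_one hc.ne']
  field_simp

/-- Weak supermajorization inequality for the concave functions `t ↦ t ^ p`, `0 < p ≤ 1`. -/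
theorem sum_rpow_le_of_tail_le {p : ℝ} (hp : 0 < p) (hp1 : p ≤ 1) (d : ℕ) (s c : ℕ → ℝ)
    (hs : ∀ j, 0 ≤ s j) (hc0 : ∀ j, 0 ≤ c j) (hc : ∀ i j, i ≤ j → j < d → c j ≤ c i)
    (h : ∀ k, ∑ j ∈ Finset.range (d - k), s (j + k) ≤ ∑ j ∈ Finset.range (d - k), c (j + k)) :
    ∑ j ∈ Finset.range d, s j ^ p ≤ ∑ j ∈ Finset.range d, c j ^ p := by
  induction d with
  | zero => simp
  | succ d ih =>
    -- Tangent lines exist only at positive points. If the smallest `c d` is zero, the last tail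
    -- forces `s d = 0` and both terms drop out.
    rcases (hc0 d).eq_or_lt with hd | hd
    · have hsd : s d = 0 := by
        have := h d
        simp only [Nat.add_sub_cancel_left, Finset.sum_range_one, zero_add, ← hd] at this
        exact le_antisymm this (hs d)
      rw [Finset.sum_range_succ, Finset.sum_range_succ, hsd, ← hd]
      refine add_le_add_left (ih (fun i j hij hj => hc i j hij (by omega)) fun k => ?_) _
      rcases le_or_gt k d with hk | hk
      · have := h k
        rw [Nat.succ_sub hk, Finset.sum_range_succ, Finset.sum_range_succ,
          Nat.sub_add_cancel hk, hsd, ← hd] at this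
        simpa using this
      · simp [Nat.sub_eq_zero_of_le hk.le]
    · have hpos : ∀ j, j < d + 1 → 0 < c j := fun j hj => hd.trans_le (hc j d (by omega) (by omega))
      have h1 : ∑ j ∈ Finset.range (d + 1), s j ^ p ≤
          ∑ j ∈ Finset.range (d + 1), (c j ^ p + p * c j ^ (p - 1) * (s j - c j)) :=
        Finset.sum_le_sum fun j hj =>
          rpow_le_tangent hp hp1 (hs j) (hpos j (Finset.mem_range.1 hj))
      have hD : ∀ k, ∑ j ∈ Finset.range (d + 1 - k), (s (j + k) - c (j + k)) ≤ 0 := fun k => by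
        rw [Finset.sum_sub_distrib]
        exact sub_nonpos.2 (h k)
      -- The tangent slopes increase with `j`, because `c` decreases and `p - 1 ≤ 0`.
      have h2 := sum_mul_le_of_tail_nonpos (d + 1) (fun j => p * c j ^ (p - 1))
        (fun j => s j - c j) (fun i j hij hj => mul_le_mul_of_nonneg_left
          (Real.rpow_le_rpow_of_nonpos (hpos j hj) (hc i j hij hj) (by linarith)) hp.le) hD
      have h3 : p * c 0 ^ (p - 1) * ∑ j ∈ Finset.range (d + 1), (s j - c j) ≤ 0 :=
        mul_nonpos_of_nonneg_of_nonpos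
          (mul_nonneg hp.le (Real.rpow_nonneg (hc0 0) _)) (by simpa using hD 0)
      rw [Finset.sum_add_distrib] at h1
      linarith

end Majorization

/-! ### Singular values: min-max bounds, Weyl, subadditivity -/

section SingularValues

variable {E F : Type*} [NormedAddCommGroup E] [InnerProductSpace ℝ E] [FiniteDimensional ℝ E]
  [NormedAddCommGroup F] [InnerProductSpace ℝ F] [FiniteDimensional ℝ F]

/-- An orthonormal basis of right singular vectors. -/
theorem exists_rightSingularBasis (T : E →ₗ[ℝ] F) :
    ∃ e : OrthonormalBasis (Fin (finrank ℝ E)) ℝ E, ∀ i,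
      T.adjoint (T (e i)) = T.singularValues i ^ 2 • e i := by
  refine ⟨T.isSymmetric_adjoint_comp_self.eigenvectorBasis rfl, fun i => ?_⟩
  rw [T.sq_singularValues_fin rfl]
  exact T.isSymmetric_adjoint_comp_self.apply_eigenvectorBasis rfl i

theorem norm_apply_sq_eq_sum {T : E →ₗ[ℝ] F} {e : OrthonormalBasis (Fin (finrank ℝ E)) ℝ E}
    (he : ∀ i, T.adjoint (T (e i)) = T.singularValues i ^ 2 • e i) (x : E) :
    ‖T x‖ ^ 2 = ∑ i : Fin (finrank ℝ E), T.singularValues i ^ 2 * inner ℝ (e i) x ^ 2 := by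
  rw [← real_inner_self_eq_norm_sq, ← LinearMap.adjoint_inner_left, ← e.sum_inner_mul_inner]
  refine Finset.sum_congr rfl fun i _ => ?_
  rw [LinearMap.adjoint_inner_left, ← LinearMap.adjoint_inner_right, he, inner_smul_right,
    real_inner_comm x]
  ring

/-- One half of the min-max principle: only the singular values from `j` on contribute to the
expansion of `‖T x‖ ^ 2`. -/
theorem norm_apply_le_of_inner_eq_zero {T : E →ₗ[ℝ] F}
    {e : OrthonormalBasis (Fin (finrank ℝ E)) ℝ E}
    (he : ∀ i, T.adjoint (T (e i)) = T.singularValues i ^ 2 • e i) (j : ℕ) (x : E)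
    (hx : ∀ i : Fin (finrank ℝ E), (i : ℕ) < j → inner ℝ (e i) x = 0) :
    ‖T x‖ ≤ T.singularValues j * ‖x‖ := by
  refine (sq_le_sq₀ (norm_nonneg _)
    (mul_nonneg (T.singularValues_nonneg j) (norm_nonneg x))).1 ?_
  rw [norm_apply_sq_eq_sum he, mul_pow, ← e.sum_sq_inner_right, Finset.mul_sum]
  refine Finset.sum_le_sum fun i _ => ?_
  rcases lt_or_ge (i : ℕ) j with h | h
  · simp [hx i h]
  · exact mul_le_mul_of_nonneg_right
      (pow_le_pow_left₀ (T.singularValues_nonneg _) (T.singularValues_antitone h) 2) (sq_nonneg _)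

theorem le_norm_apply_of_inner_eq_zero {T : E →ₗ[ℝ] F}
    {e : OrthonormalBasis (Fin (finrank ℝ E)) ℝ E}
    (he : ∀ i, T.adjoint (T (e i)) = T.singularValues i ^ 2 • e i) (j : ℕ) (x : E)
    (hx : ∀ i : Fin (finrank ℝ E), j < (i : ℕ) → inner ℝ (e i) x = 0) :
    T.singularValues j * ‖x‖ ≤ ‖T x‖ := by
  refine (sq_le_sq₀ (mul_nonneg (T.singularValues_nonneg j) (norm_nonneg x))
    (norm_nonneg _)).1 ?_
  rw [norm_apply_sq_eq_sum he, mul_pow, ← e.sum_sq_inner_right, Finset.mul_sum]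
  refine Finset.sum_le_sum fun i _ => ?_
  rcases lt_or_ge j (i : ℕ) with h | h
  · simp [hx i h]
  · exact mul_le_mul_of_nonneg_right
      (pow_le_pow_left₀ (T.singularValues_nonneg _) (T.singularValues_antitone h) 2) (sq_nonneg _)

theorem exists_ne_zero_inner_eq_zero {ι : Type*} [Fintype ι] (w : ι → E)
    (h : Fintype.card ι < finrank ℝ E) : ∃ x : E, x ≠ 0 ∧ ∀ i, inner ℝ (w i) x = 0 := by
  let Φ : E →ₗ[ℝ] (ι → ℝ) := LinearMap.pi fun i => (innerSL ℝ (w i)).toLinearMap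
  obtain ⟨x, hx, hx0⟩ := (Submodule.ne_bot_iff _).1
    (LinearMap.ker_ne_bot_of_finrank_lt (f := Φ) (by simpa using h))
  exact ⟨x, hx0, fun i => congrFun (LinearMap.mem_ker.1 hx) i⟩

/-- Weyl's inequality for perturbations of rank at most `s.card`. -/
theorem singularValues_add_card_le {ι : Type*} (T S : E →ₗ[ℝ] F) (s : Finset ι) (v : ι → E)
    (h : ∀ x, (∀ i ∈ s, inner ℝ (v i) x = 0) → T x = S x) (j : ℕ) :
    T.singularValues (j + s.card) ≤ S.singularValues j := by
  rcases le_or_gt (finrank ℝ E) (j + s.card) with hj | hj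
  · rw [T.singularValues_of_finrank_le hj]
    exact S.singularValues_nonneg j
  obtain ⟨e, he⟩ := exists_rightSingularBasis T
  obtain ⟨g, hg⟩ := exists_rightSingularBasis S
  -- These are `finrank ℝ E - 1` conditions in all, so a nonzero `x` meets them: it lies in the top
  -- space of `T`, avoids the top `j` directions of `S`, and satisfies `T x = S x`.
  let w : Fin (finrank ℝ E - (j + s.card) - 1) ⊕ Fin j ⊕ s → E :=
    Sum.elim (fun i => e ⟨j + s.card + 1 + i, by omega⟩)
      (Sum.elim (fun i => g ⟨i, by omega⟩) fun i => v i)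
  obtain ⟨x, hx0, hx⟩ := exists_ne_zero_inner_eq_zero w (by simp; omega)
  have h1 := le_norm_apply_of_inner_eq_zero he (j + s.card) x fun i hi => by
    convert hx (Sum.inl ⟨i - (j + s.card + 1), by omega⟩) using 3
    simp only [w, Sum.elim_inl]
    congr 1
    ext
    simp
    omega
  have h2 := norm_apply_le_of_inner_eq_zero hg j x fun i hi => hx (Sum.inr (Sum.inl ⟨i, hi⟩))
  rw [h x fun i hi => hx (Sum.inr (Sum.inr ⟨i, hi⟩))] at h1
  exact le_of_mul_le_mul_right (h1.trans h2) (norm_pos_iff.2 hx0)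

/-- The reduced singular value decomposition. -/
theorem exists_reduced_svd (T : E →ₗ[ℝ] F) :
    ∃ (f : Fin (finrank ℝ T.range) → F) (e : Fin (finrank ℝ T.range) → E),
      Orthonormal ℝ f ∧ Orthonormal ℝ e ∧ (∀ i, T (e i) = T.singularValues i • f i) ∧
      ∀ x, T x = ∑ i, inner ℝ (e i) x • T.singularValues i • f i := by
  obtain ⟨e, he⟩ := exists_rightSingularBasis T
  have hle : finrank ℝ T.range ≤ finrank ℝ E := T.finrank_range_le
  have hpos : ∀ i : Fin (finrank ℝ T.range), T.singularValues i ≠ 0 := fun i =>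
    (T.singularValues_pos_iff_lt_finrank_range.2 i.2).ne'
  have hTe : ∀ i : Fin (finrank ℝ T.range), T (e (Fin.castLE hle i)) =
      T.singularValues i • (T.singularValues i)⁻¹ • T (e (Fin.castLE hle i)) := fun i => by
    rw [smul_inv_smul₀ (hpos i)]
  refine ⟨fun i => (T.singularValues i)⁻¹ • T (e (Fin.castLE hle i)),
    fun i => e (Fin.castLE hle i), ?_, e.orthonormal.comp _ (Fin.castLE_injective hle), hTe,
    fun x => ?_⟩
  · rw [orthonormal_iff_ite]
    intro i k
    rw [real_inner_smul_left, real_inner_smul_right, ← LinearMap.adjoint_inner_right, he,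
      real_inner_smul_right, orthonormal_iff_ite.1 e.orthonormal]
    by_cases hik : i = k
    · subst hik
      have := hpos i
      simp
      field_simp
    · simp [hik]
  · conv_lhs => rw [← e.sum_repr' x, map_sum]
    symm
    refine Fintype.sum_of_injective (Fin.castLE hle) (Fin.castLE_injective hle) _ _
      (fun i hi => ?_) fun i => ?_
    · have hi' : finrank ℝ T.range ≤ i := by
        by_contra hlt
        exact hi ⟨⟨i, not_le.1 hlt⟩, rfl⟩
      have : T (e i) = 0 := by
        rw [← norm_eq_zero, ← sq_eq_zero_iff, ← real_inner_self_eq_norm_sq,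
          ← LinearMap.adjoint_inner_right, he,
          T.singularValues_eq_zero_iff_le_finrank_range.2 hi']
        simp
      simp [this]
    · rw [map_smul, ← hTe]

/-- The nuclear norm of a sum of rank-one maps is at most the sum of their nuclear norms. -/
theorem sum_singularValues_le {ι : Type*} (T : E →ₗ[ℝ] F) (t : Finset ι) (u : ι → F) (v : ι → E)
    (h : ∀ x, T x = ∑ i ∈ t, inner ℝ (v i) x • u i) (N : ℕ) :
    ∑ j ∈ Finset.range N, T.singularValues j ≤ ∑ i ∈ t, ‖u i‖ * ‖v i‖ := by
  obtain ⟨f, e, hf, he, hfe, -⟩ := exists_reduced_svd T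
  have h1 : ∑ j ∈ Finset.range N, T.singularValues j ≤
      ∑ j ∈ Finset.range (finrank ℝ T.range), T.singularValues j := by
    rw [← Finset.sum_filter_ne_zero, ← T.support_singularValues]
    refine Finset.sum_le_sum_of_subset_of_nonneg (fun j hj => ?_)
      fun j _ _ => T.singularValues_nonneg j
    exact Finsupp.mem_support_iff.2 (Finset.mem_filter.1 hj).2
  refine h1.trans ?_
  rw [Finset.sum_range]
  have h2 : ∀ j : Fin (finrank ℝ T.range), T.singularValues j =
      ∑ i ∈ t, inner ℝ (f j) (u i) * inner ℝ (e j) (v i) := fun j => by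
    have h3 : inner ℝ (f j) (T (e j)) = T.singularValues j := by
      rw [hfe, real_inner_smul_right, real_inner_self_eq_norm_sq, hf.1 j]
      simp
    rw [← h3, h, inner_sum]
    refine Finset.sum_congr rfl fun i _ => ?_
    rw [real_inner_smul_right, real_inner_comm, mul_comm]
  simp_rw [h2]
  rw [Finset.sum_comm]
  -- Cauchy-Schwarz over `j`, then Bessel's inequality for `f` and for `e`.
  refine Finset.sum_le_sum fun i _ => (Real.sum_mul_le_sqrt_mul_sqrt _ _ _).trans ?_
  gcongr
  · refine Real.sqrt_le_iff.2 ⟨norm_nonneg _, ?_⟩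
    simpa using hf.sum_inner_products_le (u i) (s := Finset.univ)
  · refine Real.sqrt_le_iff.2 ⟨norm_nonneg _, ?_⟩
    simpa using he.sum_inner_products_le (v i) (s := Finset.univ)

/-- Subadditivity of `∑ j, σ j ^ p`, `0 < p ≤ 1`, over rank-one decompositions. -/
theorem sum_singularValues_rpow_le {p : ℝ} (hp : 0 < p) (hp1 : p ≤ 1) {d : ℕ} (T : E →ₗ[ℝ] F)
    (u : Fin d → F) (v : Fin d → E) (h : ∀ x, T x = ∑ i, inner ℝ (v i) x • u i) :
    ∑ j ∈ Finset.range d, T.singularValues j ^ p ≤ ∑ i, (‖u i‖ * ‖v i‖) ^ p := by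
  wlog hanti : Antitone fun i => ‖u i‖ * ‖v i‖ generalizing u v
  · let π := Tuple.sort fun i => -(‖u i‖ * ‖v i‖)
    have hπ : Monotone _ := Tuple.monotone_sort fun i => -(‖u i‖ * ‖v i‖)
    refine (this (u ∘ π) (v ∘ π) (fun x => ?_) fun i j hij => neg_le_neg_iff.1 (hπ hij)).trans_eq ?_
    · rw [h]
      exact (Equiv.sum_comp π fun i => inner ℝ (v i) x • u i).symm
    · exact Equiv.sum_comp π fun i => (‖u i‖ * ‖v i‖) ^ p
  let c : ℕ → ℝ := fun i => if hi : i < d then ‖u ⟨i, hi⟩‖ * ‖v ⟨i, hi⟩‖ else 0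
  have hc : ∀ i : Fin d, c i = ‖u i‖ * ‖v i‖ := fun i => by simp [c]
  have hmain := sum_rpow_le_of_tail_le hp hp1 d T.singularValues c T.singularValues_nonneg
    (fun j => by simp only [c]; split_ifs <;> positivity)
    (fun i j hij hj => by
      simp only [c, hj, hij.trans_lt hj, dite_true]
      exact hanti (Fin.mk_le_mk.2 hij)) fun k => ?_
  · refine hmain.trans_eq ?_
    rw [Finset.sum_range]
    simp_rw [hc]
  rcases le_or_gt k d with hk | hk
  swap
  · simp [Nat.sub_eq_zero_of_le hk.le]
  -- `s` indexes the `k` largest products; `S` keeps the other terms.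
  let s : Finset (Fin d) := Finset.univ.filter fun i => (i : ℕ) < k
  have hs : s.card = k := by
    simp [s, Fin.card_filter_val_lt, hk]
  let S : E →ₗ[ℝ] F := ∑ i ∈ sᶜ, (innerSL ℝ (v i)).toLinearMap.smulRight (u i)
  have hS : ∀ x, S x = ∑ i ∈ sᶜ, inner ℝ (v i) x • u i := fun x => by
    simp [S, LinearMap.sum_apply]
  have hTS : ∀ x, (∀ i ∈ s, inner ℝ (v i) x = 0) → T x = S x := fun x hx => by
    rw [h, hS, ← Finset.sum_add_sum_compl s, Finset.sum_eq_zero, zero_add]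
    intro i hi
    rw [hx i hi, zero_smul]
  have hweyl := singularValues_add_card_le T S s v hTS
  rw [hs] at hweyl
  refine (Finset.sum_le_sum fun j _ => hweyl j).trans
    ((sum_singularValues_le S sᶜ u v hS (d - k)).trans_eq ?_)
  refine (Finset.sum_nbij (fun j => j + k) (s := Finset.range (d - k)) (t := Finset.Ico k d)
    (g := c) (fun j hj => ?_) (fun i _ j _ hij => by simpa using hij) (fun j hj => ?_)
    fun _ _ => rfl).symm ▸ ?_
  · simp at hj ⊢; omega
  · simp at hj ⊢; exact ⟨j - k, by omega, by omega⟩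
  · refine Finset.sum_nbij (fun i => (i : ℕ)) (fun i hi => ?_) (fun i _ j _ hij => Fin.ext hij)
      (fun j hj => ?_) fun i _ => (hc i).symm
    · simpa [s] using hi
    · simp at hj
      exact ⟨⟨j, hj.2⟩, by simpa [s] using hj.1, rfl⟩

end SingularValues

/-! ### Optimal cost of a single term -/

section ScalarCosts

theorem rpow_cost₁_le {α q s t : ℝ} (hα : 0 < α) (hq : 0 < q) (hs : 0 ≤ s) (ht : 0 ≤ t) :
    (1 + 1 / q) * α ^ (q / (q + 1)) * (s * t) ^ (q / (q + 1)) ≤ (1 / q) * s ^ q + α * t := by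
  have h := Real.geom_mean_le_arith_mean2_weighted (w₁ := 1 / (q + 1)) (w₂ := q / (q + 1))
    (p₁ := s ^ q) (p₂ := α * t) (by positivity) (by positivity) (by positivity) (by positivity)
    (by field_simp; ring)
  rw [← Real.rpow_mul hs, mul_one_div, Real.mul_rpow hα.le ht] at h
  rw [Real.mul_rpow hs ht]
  have h' := mul_le_mul_of_nonneg_left h (by positivity : 0 ≤ 1 + 1 / q)
  calc _ = (1 + 1 / q) * (s ^ (q / (q + 1)) * (α ^ (q / (q + 1)) * t ^ (q / (q + 1)))) := by ring
    _ ≤ _ := h'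
    _ = _ := by field_simp

theorem rpow_cost₂_le {α q s t : ℝ} (hα : 0 < α) (hq : 0 < q) (hs : 0 ≤ s) (ht : 0 ≤ t) :
    (1 / 2 + 1 / q) * α ^ (q / (q + 2)) * (s * t) ^ (2 * q / (2 + q)) ≤
      (1 / q) * s ^ q + (α / 2) * t ^ 2 := by
  have h := Real.geom_mean_le_arith_mean2_weighted (w₁ := 2 / (q + 2)) (w₂ := q / (q + 2))
    (p₁ := s ^ q) (p₂ := α * t ^ 2) (by positivity) (by positivity) (by positivity) (by positivity)
    (by field_simp; ring)
  rw [← Real.rpow_mul hs, Real.mul_rpow hα.le (by positivity), ← Real.rpow_natCast t 2,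
    ← Real.rpow_mul ht, show q * (2 / (q + 2)) = 2 * q / (2 + q) by field_simp; ring,
    show ((2 : ℕ) : ℝ) * (q / (q + 2)) = 2 * q / (2 + q) by push_cast; field_simp; ring,
    Real.rpow_natCast] at h
  rw [Real.mul_rpow hs ht]
  have h' := mul_le_mul_of_nonneg_left h (by positivity : 0 ≤ 1 / 2 + 1 / q)
  calc _ = (1 / 2 + 1 / q) * (s ^ (2 * q / (2 + q)) *
        (α ^ (q / (q + 2)) * t ^ (2 * q / (2 + q)))) := by ring
    _ ≤ _ := h'
    _ = _ := by field_simp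

theorem exists_cost₁_eq {α q c : ℝ} (hα : 0 < α) (hq : 0 < q) (hc : 0 < c) :
    ∃ s t : ℝ, 0 ≤ s ∧ 0 ≤ t ∧ s * t = c ∧
      (1 / q) * s ^ q + α * t = (1 + 1 / q) * α ^ (q / (q + 1)) * c ^ (q / (q + 1)) := by
  have hac : 0 < α * c := mul_pos hα hc
  have hs : 0 < (α * c) ^ (1 / (q + 1)) := Real.rpow_pos_of_pos hac _
  -- Equality in AM-GM requires `s ^ q = α * t`; with `s * t = c` this gives `s ^ (q + 1) = α * c`.
  refine ⟨(α * c) ^ (1 / (q + 1)), c / (α * c) ^ (1 / (q + 1)), hs.le, by positivity,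
    mul_div_cancel₀ _ hs.ne', ?_⟩
  have h1 : α * (c / (α * c) ^ (1 / (q + 1))) = (α * c) ^ (q / (q + 1)) := by
    rw [← mul_div_assoc, div_eq_iff hs.ne', ← Real.rpow_add hac,
      show q / (q + 1) + 1 / (q + 1) = 1 by field_simp, Real.rpow_one]
  rw [h1, ← Real.rpow_mul hac.le, show 1 / (q + 1) * q = q / (q + 1) by ring,
    Real.mul_rpow hα.le hc.le]
  ring

theorem exists_cost₂_eq {α q c : ℝ} (hα : 0 < α) (hq : 0 < q) (hc : 0 < c) :
    ∃ s t : ℝ, 0 ≤ s ∧ 0 ≤ t ∧ s * t = c ∧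
      (1 / q) * s ^ q + (α / 2) * t ^ 2 =
        (1 / 2 + 1 / q) * α ^ (q / (q + 2)) * c ^ (2 * q / (2 + q)) := by
  have hac : 0 < α * c ^ 2 := by positivity
  have hs : 0 < (α * c ^ 2) ^ (1 / (q + 2)) := Real.rpow_pos_of_pos hac _
  -- Here equality requires `s ^ q = α * t ^ 2`, hence `s ^ (q + 2) = α * c ^ 2`.
  refine ⟨(α * c ^ 2) ^ (1 / (q + 2)), c / (α * c ^ 2) ^ (1 / (q + 2)), hs.le, by positivity,
    mul_div_cancel₀ _ hs.ne', ?_⟩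
  have h1 : α * (c / (α * c ^ 2) ^ (1 / (q + 2))) ^ 2 = (α * c ^ 2) ^ (q / (q + 2)) := by
    rw [div_pow, ← mul_div_assoc, div_eq_iff (by positivity), ← Real.rpow_mul_natCast hac.le,
      ← Real.rpow_add hac,
      show q / (q + 2) + 1 / (q + 2) * (2 : ℕ) = 1 by push_cast; field_simp, Real.rpow_one]
  have h2 : (α * c ^ 2) ^ (q / (q + 2)) = α ^ (q / (q + 2)) * c ^ (2 * q / (2 + q)) := by
    rw [Real.mul_rpow hα.le (by positivity), ← Real.rpow_natCast_mul hc.le]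
    congr 2
    push_cast
    field_simp
    ring
  rw [div_mul_eq_mul_div α, h1, ← Real.rpow_mul hac.le, show 1 / (q + 2) * q = q / (q + 2) by ring,
    h2]
  ring

end ScalarCosts

/-! ### From rank-one sums to matrix factorizations -/

section Factorizations

variable {m n d : ℕ} {X : Matrix (Fin m) (Fin n) ℝ}

theorem isFactorization_iff {a : Fin d → EuclideanSpace ℝ (Fin m)}
    {b : Fin d → EuclideanSpace ℝ (Fin n)} :
    IsFactorization X a b ↔ ∀ x, Matrix.toEuclideanLin X x = ∑ j, inner ℝ (b j) x • a j := by
  have h : ∀ x, Matrix.toEuclideanLin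
      (∑ j, Matrix.vecMulVec (WithLp.ofLp (a j)) (WithLp.ofLp (b j))) x =
        ∑ j, inner ℝ (b j) x • a j := fun x => by
    rw [map_sum, LinearMap.sum_apply]
    refine Finset.sum_congr rfl fun j _ => ?_
    ext i
    simp [Matrix.toLpLin_apply, Matrix.vecMulVec_mulVec, PiLp.inner_apply, dotProduct, mul_comm]
  refine ⟨fun hX x => ?_, fun hX => (Matrix.toEuclideanLin (𝕜 := ℝ)).injective ?_⟩
  · rw [← h x, ← hX]
  · ext1 x
    rw [hX, h]

theorem finrank_range_toEuclideanLin (X : Matrix (Fin m) (Fin n) ℝ) :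
    finrank ℝ (Matrix.toEuclideanLin X).range = X.rank := by
  rw [Matrix.toEuclideanLin_eq_toLin_orthonormal]
  exact (Matrix.rank_eq_finrank_range_toLin X _ _).symm

theorem sum_sv_rpow_eq {p : ℝ} (hp : p ≠ 0) {N : ℕ} (h : X.rank ≤ N) :
    ∑ j ∈ Finset.range N, sv X j ^ p = ∑ j ∈ Finset.range X.rank, sv X j ^ p := by
  refine (Finset.sum_subset (Finset.range_mono h) fun j _ hj => ?_).symm
  have : sv X j = 0 := (LinearMap.singularValues_eq_zero_iff_le_finrank_range _).2 <| by
    rw [finrank_range_toEuclideanLin]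
    simpa using hj
  rw [this, Real.zero_rpow hp]

/-- If the optimal value of a two-variable cost under the constraint `s * t = c` is `K * c ^ p`,
then the minimal total cost of a factorization of `X` is `K` times the `p`-th power of its
Schatten-`p` quasi-norm. -/
theorem isLeast_factorization_cost {p K : ℝ} (hp : 0 < p) (hp1 : p ≤ 1) (hK : 0 ≤ K)
    (φ : ℝ → ℝ → ℝ) (hφ0 : φ 0 0 = 0)
    (hφ : ∀ s t, 0 ≤ s → 0 ≤ t → K * (s * t) ^ p ≤ φ s t)
    (hφ' : ∀ c, 0 < c → ∃ s t, 0 ≤ s ∧ 0 ≤ t ∧ s * t = c ∧ φ s t = K * c ^ p)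
    (hd : X.rank ≤ d) :
    IsLeast {v | ∃ (a : Fin d → EuclideanSpace ℝ (Fin m)) (b : Fin d → EuclideanSpace ℝ (Fin n)),
      IsFactorization X a b ∧ v = ∑ j, φ ‖a j‖ ‖b j‖}
      (K * ∑ j ∈ Finset.range X.rank, sv X j ^ p) := by
  constructor
  · obtain ⟨f, e, hf, he, -, hX⟩ := exists_reduced_svd (Matrix.toEuclideanLin X)
    have hpos : ∀ i : Fin (finrank ℝ (Matrix.toEuclideanLin X).range), 0 < sv X i := fun i =>
      (LinearMap.singularValues_pos_iff_lt_finrank_range _).2 i.2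
    rw [← finrank_range_toEuclideanLin] at hd ⊢
    choose s t hs ht hst hcost using fun i => hφ' _ (hpos i)
    have hinj := Fin.castLE_injective hd
    have hext : ∀ i, i ∉ Set.range (Fin.castLE hd) → ¬∃ k, Fin.castLE hd k = i := fun _ h => h
    -- Each singular value is split as `s i * t i` at optimal cost; the `d - rank` spare terms are
    -- zero and cost nothing since `φ 0 0 = 0`.
    refine ⟨Function.extend (Fin.castLE hd) (fun i => s i • f i) 0,
      Function.extend (Fin.castLE hd) (fun i => t i • e i) 0, isFactorization_iff.2 fun x => ?_, ?_⟩
    · rw [hX]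
      refine Fintype.sum_of_injective _ hinj _ _ (fun i hi => ?_) fun i => ?_
      · rw [Function.extend_apply' _ _ _ (hext i hi), Function.extend_apply' _ _ _ (hext i hi)]
        simp
      · rw [hinj.extend_apply, hinj.extend_apply, real_inner_smul_left, smul_smul, smul_smul]
        congr 1
        rw [show (Matrix.toEuclideanLin X).singularValues i = s i * t i from (hst i).symm]
        ring
    · rw [Finset.mul_sum, Finset.sum_range]
      refine Fintype.sum_of_injective _ hinj _ _ (fun i hi => ?_) fun i => ?_
      · rw [Function.extend_apply' _ _ _ (hext i hi), Function.extend_apply' _ _ _ (hext i hi)]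
        simpa using hφ0
      · rw [hinj.extend_apply, hinj.extend_apply, norm_smul, norm_smul, hf.1, he.1, mul_one,
          mul_one, Real.norm_of_nonneg (hs i), Real.norm_of_nonneg (ht i), hcost]
  · rintro _ ⟨a, b, hab, rfl⟩
    rw [← sum_sv_rpow_eq hp.ne' hd]
    refine (mul_le_mul_of_nonneg_left (sum_singularValues_rpow_le hp hp1 _ a b
      (isFactorization_iff.1 hab)) hK).trans ?_
    rw [Finset.mul_sum]
    exact Finset.sum_le_sum fun j _ => hφ _ _ (norm_nonneg _) (norm_nonneg _)

theorem isLeast_values₁ {α q : ℝ} (hα : 0 < α) (hq : 0 < q) (hd : X.rank ≤ d) :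
    IsLeast (values₁ X d α q) ((1 + 1 / q) * α ^ (q / (q + 1)) *
      ∑ j ∈ Finset.range X.rank, sv X j ^ (q / (q + 1))) :=
  isLeast_factorization_cost (by positivity) ((div_le_one (by positivity)).2 (by linarith))
    (by positivity) (fun s t => (1 / q) * s ^ q + α * t) (by simp [Real.zero_rpow hq.ne'])
    (fun _ _ hs ht => rpow_cost₁_le hα hq hs ht) (fun _ hc => exists_cost₁_eq hα hq hc) hd

/-- The bound `q ≤ 2` is what makes `2 * q / (2 + q) ≤ 1`, as concavity requires. -/
theorem isLeast_values₂ {α q : ℝ} (hα : 0 < α) (hq : 0 < q) (hq2 : q ≤ 2) (hd : X.rank ≤ d) :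
    IsLeast (values₂ X d α q) ((1 / 2 + 1 / q) * α ^ (q / (q + 2)) *
      ∑ j ∈ Finset.range X.rank, sv X j ^ (2 * q / (2 + q))) :=
  isLeast_factorization_cost (by positivity) ((div_le_one (by positivity)).2 (by linarith))
    (by positivity) (fun s t => (1 / q) * s ^ q + (α / 2) * t ^ 2)
    (by simp [Real.zero_rpow hq.ne']) (fun _ _ hs ht => rpow_cost₂_le hα hq hs ht)
    (fun _ hc => exists_cost₂_eq hα hq hc) hd

theorem schatten_rpow {p : ℝ} (hp : 0 < p) (X : Matrix (Fin m) (Fin n) ℝ) :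
    schatten p X ^ p = ∑ j ∈ Finset.range X.rank, sv X j ^ p := by
  have h : X.rank ≤ min m n := le_min X.rank_le_height X.rank_le_width
  rw [schatten, ← Real.rpow_mul, one_div_mul_cancel hp.ne', Real.rpow_one, sum_sv_rpow_eq hp.ne' h]
  exact Finset.sum_nonneg fun j _ => Real.rpow_nonneg (LinearMap.singularValues_nonneg _ j) _

end Factorizations

theorem pos_of_mem_exponents {q : ℝ} (hq : q ∈ exponents) : 0 < q := by
  obtain ⟨k, rfl⟩ := hq
  positivity

theorem le_one_of_mem_exponents {q : ℝ} (hq : q ∈ exponents) : q ≤ 1 := by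
  obtain ⟨k, rfl⟩ := hq
  exact pow_le_one₀ (by norm_num) (by norm_num)

theorem exists_mem_exponents_lt {ε : ℝ} (hε : 0 < ε) : ∃ q ∈ exponents, q < ε := by
  obtain ⟨k, hk⟩ := exists_pow_lt_of_lt_one hε (by norm_num : (1 : ℝ) / 2 < 1)
  exact ⟨_, ⟨k, rfl⟩, hk⟩

end FGSR

theorem theorem2 (α : ℝ) (hα : 0 < α) (m n d r : ℕ) (X : Matrix (Fin m) (Fin n) ℝ)
    (hr : X.rank = r) (hrd : r ≤ d) (hd : d ≤ min m n) :
    (∀ q ∈ FGSR.exponents,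
      IsLeast (FGSR.values₁ X d α q)
        ((1 + 1 / q) * α ^ (q / (q + 1)) *
          ∑ j ∈ Finset.range r, FGSR.sv X j ^ (q / (q + 1))) ∧
      IsLeast (FGSR.values₂ X d α q)
        ((1 / 2 + 1 / q) * α ^ (q / (q + 2)) *
          ∑ j ∈ Finset.range r, FGSR.sv X j ^ (2 * q / (2 + q)))) ∧
    (∀ ε : ℝ, 0 < ε → ∃ q ∈ FGSR.exponents, ∃ p : ℝ, 0 < p ∧ p < ε ∧ p = q / (q + 1) ∧
      IsLeast (FGSR.values₁ X d α q) ((1 + 1 / q) * α ^ p * FGSR.schatten p X ^ p)) ∧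
    (∀ ε : ℝ, 0 < ε → ∃ q ∈ FGSR.exponents, ∃ p : ℝ, 0 < p ∧ p < ε ∧ p = 2 * q / (2 + q) ∧
      IsLeast (FGSR.values₂ X d α q) ((1 / 2 + 1 / q) * α ^ (p / 2) * FGSR.schatten p X ^ p)) := by
  subst hr
  refine ⟨fun q hq => ⟨FGSR.isLeast_values₁ hα (FGSR.pos_of_mem_exponents hq) hrd,
    FGSR.isLeast_values₂ hα (FGSR.pos_of_mem_exponents hq)
      ((FGSR.le_one_of_mem_exponents hq).trans one_le_two) hrd⟩, fun ε hε => ?_, fun ε hε => ?_⟩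
  -- In both cases `p ≤ q`, so it suffices to take `q < ε`.
  · obtain ⟨q, hq, hqε⟩ := FGSR.exists_mem_exponents_lt hε
    have hq0 := FGSR.pos_of_mem_exponents hq
    refine ⟨q, hq, q / (q + 1), by positivity,
      (div_le_self hq0.le (by linarith)).trans_lt hqε, rfl, ?_⟩
    rw [FGSR.schatten_rpow (by positivity)]
    exact FGSR.isLeast_values₁ hα hq0 hrd
  · obtain ⟨q, hq, hqε⟩ := FGSR.exists_mem_exponents_lt hε
    have hq0 := FGSR.pos_of_mem_exponents hq
    refine ⟨q, hq, 2 * q / (2 + q), by positivity, lt_of_le_of_lt ?_ hqε, rfl, ?_⟩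
    · rw [div_le_iff₀ (by positivity)]
      nlinarith
    · rw [FGSR.schatten_rpow (by positivity), show 2 * q / (2 + q) / 2 = q / (q + 2) by
        field_simp; ring]
      exact FGSR.isLeast_values₂ hα hq0
        ((FGSR.le_one_of_mem_exponents hq).trans one_le_two) hrd
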